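/- Fix $d$, $\theta^*\in\mathbb R^d$, $\sigma>0$ and $\delta>0$. For every horizon $n\ge 1$ consider a probability space with a filtration $(\mathcal F_t)_{t\ge 0}$, covariates $x_1,\dots,x_n\in\mathbb R^d$ and responses $y_t=x_t^\top\theta^*+\epsilon_t$ $(1\le t\le n)$ such that $x_1,y_1,\dots,x_{t-1},y_{t-1},x_t$ are $\mathcal F_{t-1}$-measurable and $\|x_t\|_2\le 1$ almost surely for $1\le t\le n$; all these objects may depend on $n$ (a single infinite data sequence is a special case). Assume that for $1\le t\le n$ $$\mathbb E[\epsilon_t\mid\mathcal F_{t-1}]=0,\qquad \mathbb E[\epsilon_t^2\mid\mathcal F_{t-1}]=\sigma^2,$$ and that $\max_{1\le t\le n}\mathbb E[|\epsilon_t/\sigma|^{2+\delta}\mid\mathcal F_{t-1}]$ is bounded in probability as $n\to\infty$ (for a single data sequence this holds as soon as $\sup_{t\ge1}\mathbb E[|\epsilon_t/\sigma|^{2+\delta}\mid\mathcal F_{t-1}]<\infty$ almost surely). Let $\Sigma_0=\Sigma_0^{(n)}$ be an $\mathcal F_0$-measurable random positive definite $d\times d$ matrix, and put $$\Sigma_t=\Sigma_0+\sum_{i=1}^t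 x_ix_i^\top,\quad z_t=\Sigma_{t-1}^{-1/2}x_t,\quad V_t=\Big(I_d+\sum_{i=1}^t z_iz_i^\top\Big)^{-1},\quad w_t=\sqrt{1+z_t^\top V_{t-1}z_t}\;V_tz_t .$$ Let $\hat\theta_{\mathrm{ALEE}}=\hat\theta_{\mathrm{ALEE}}^{(n)}$ be random vectors that, with probability tending to one as $n\to\infty$, solve the estimating equation $\sum_{t=1}^n w_t\,(y_t-x_t^\top\hat\theta_{\mathrm{ALEE}})=0$. If, as $n\to\infty$, $\lambda_{\min}(\Sigma_0)\to\infty$ in probability and $\lambda_{\min}(V_n^{-1})\to\infty$ in probability, then $$\frac1\sigma\Big(\sum_{t=1}^n w_tx_t^\top\Big)\big(\hat\theta_{\mathrm{ALEE}}-\theta^*\big)\;\xrightarrow{\ d\ }\;\mathcal N(0,I_d).$$ -/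

import Mathlib

open MeasureTheory ProbabilityTheory Filter
open scoped Topology ENNReal MatrixOrder

namespace ContextualALEE

/-- `λ_min(A)`: the smallest eigenvalue of a (symmetric) real matrix. -/
noncomputable def lambdaMin {d : ℕ} (A : Matrix (Fin d) (Fin d) ℝ) : ℝ :=
  sInf (spectrum ℝ A)

/-- `f n → +∞` in probability; the random variables may live on different probability spaces. -/
def TendstoInProbabilityAtTop {Ω : ℕ → Type*} [∀ n, MeasurableSpace (Ω n)]
    (μ : ∀ n, Measure (Ω n)) (f : ∀ n, Ω n → ℝ) : Prop :=
  ∀ M : ℝ, Tendsto (fun n => μ n {ω | f n ω ≤ M}) atTop (𝓝 0)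

/-- The events `A n` have probability tending to one. -/
def WithHighProbability {Ω : ℕ → Type*} [∀ n, MeasurableSpace (Ω n)]
    (μ : ∀ n, Measure (Ω n)) (A : ∀ n, Set (Ω n)) : Prop :=
  Tendsto (fun n => μ n (A n)ᶜ) atTop (𝓝 0)

section Weights

/-! In this section `S₀` is a fixed matrix and `x 1, x 2, …` a fixed sequence of vectors
(one realisation of the random ones); `x 0` is never used. -/

variable {d : ℕ} (S₀ : Matrix (Fin d) (Fin d) ℝ) (x : ℕ → EuclideanSpace ℝ (Fin d))

/-- `Σ_t = Σ_0 + ∑_{i=1}^t x_i x_iᵀ`. -/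
noncomputable def sigmaMat (t : ℕ) : Matrix (Fin d) (Fin d) ℝ :=
  S₀ + ∑ i ∈ Finset.Icc 1 t, Matrix.vecMulVec (x i).ofLp (x i).ofLp

/-- `z_t = Σ_{t-1}^{-1/2} x_t` for `t ≥ 1`, with the positive definite square root. -/
noncomputable def zVec (t : ℕ) : EuclideanSpace ℝ (Fin d) :=
  Matrix.toEuclideanCLM (𝕜 := ℝ) (CFC.sqrt (sigmaMat S₀ x (t - 1)))⁻¹ (x t)

/-- The variability matrix `V_t = (I + ∑_{i=1}^t z_i z_iᵀ)⁻¹`; in particular `V_0 = I`. -/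
noncomputable def variabilityMat (t : ℕ) : Matrix (Fin d) (Fin d) ℝ :=
  (1 + ∑ i ∈ Finset.Icc 1 t, Matrix.vecMulVec (zVec S₀ x i).ofLp (zVec S₀ x i).ofLp)⁻¹

/-- The weights `w_t = √(1 + z_tᵀ V_{t-1} z_t) V_t z_t` for `t ≥ 1`. -/
noncomputable def weight (t : ℕ) : EuclideanSpace ℝ (Fin d) :=
  √(1 + inner ℝ (zVec S₀ x t)
      (Matrix.toEuclideanCLM (𝕜 := ℝ) (variabilityMat S₀ x (t - 1)) (zVec S₀ x t))) •
    Matrix.toEuclideanCLM (𝕜 := ℝ) (variabilityMat S₀ x t) (zVec S₀ x t)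

/-- `∑_{t=1}^n w_t x_tᵀ`. -/
noncomputable def weightedDesign (n : ℕ) : Matrix (Fin d) (Fin d) ℝ :=
  ∑ t ∈ Finset.Icc 1 n, Matrix.vecMulVec (weight S₀ x t).ofLp (x t).ofLp

/-- `θ` solves the adaptive linear estimating equation `∑_{t=1}^n w_t (y_t - x_tᵀ θ) = 0`. -/
def IsALEE (y : ℕ → ℝ) (n : ℕ) (θ : EuclideanSpace ℝ (Fin d)) : Prop :=
  ∑ t ∈ Finset.Icc 1 n, (y t - inner ℝ (x t) θ) • weight S₀ x t = 0

end Weights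

end ContextualALEE

/-! The weights make the conditional covariance almost deterministic. Sherman–Morrison gives
`w_{t+1} w_{t+1}ᵀ = V_t - V_{t+1}` (`vecMulVec_weight`), so `∑ w_t w_tᵀ = I - V_n`. On the event
that the estimating equation holds, the normalised error is the martingale transform `∑ w_t ε_t /
σ`. In direction `u` its conditional variance is `‖u‖² - uᵀ V_n u`: never above `‖u‖²`, and close to
it once `λ_min(V_n⁻¹)` is large. Each weight is uniformly small, since `‖w_t‖ ≤ ‖z_t‖ ≤
λ_min(Σ_0)^(-1/2)` when `‖x_t‖ ≤ 1`.

The central limit theorem is then proved by characteristic functions. For predictable `a_s` with `Q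
= ∑ a_s² ≤ c`, the compensated exponential `exp(i ∑ a_s ξ_s + Q/2)` has mean nearly one: each step
changes the mean by at most a small constant times `E a_s²`, and these sum to at most `c`
(`norm_integral_exp_sum_sub_one_le`). Replacing `Q` by its near-limit `c` gives `exp(-c/2)`
(`norm_integral_exp_sub_exp_le`).

Hypotheses valid only with high probability are handled by a predictable truncation of the
coefficients (`norm_charFun_alee_sub_le`), giving a bound for each horizon. Lévy's continuity
theorem concludes. -/

namespace ContextualALEE

/-- Second-order Taylor bound for `exp (i x)`, interpolated between the exponents `2` and `3`. -/
lemma norm_exp_mul_I_sub_taylor_le {γ : ℝ} (hγ₀ : 0 ≤ γ) (hγ₁ : γ ≤ 1) (x : ℝ) :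
    ‖Complex.exp (x * Complex.I) - (1 + x * Complex.I - (x : ℂ) ^ 2 / 2)‖
      ≤ 4 * |x| ^ (2 + γ) := by
  -- For `|x| ≤ 1` the cubic remainder suffices because `2 + γ ≤ 3`; for `|x| ≥ 1` the trivial bound
  -- `2 + |x| + x²/2` is at most `4 x²`.
  rcases le_total |x| 1 with hx | hx
  · have h := Complex.exp_bound (x := x * Complex.I) (by simpa using hx) (n := 3) (by norm_num)
    have e : ∑ m ∈ Finset.range 3, ((x : ℂ) * Complex.I) ^ m / (m.factorial : ℂ)
        = 1 + x * Complex.I - (x : ℂ) ^ 2 / 2 := by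
      simp [Finset.sum_range_succ, mul_pow]
      ring
    rw [e] at h
    refine h.trans ?_
    have h3 : |x| ^ 3 ≤ |x| ^ (2 + γ) := by
      rw [← Real.rpow_natCast]
      rcases eq_or_lt_of_le (abs_nonneg x) with h0 | h0
      · rw [← h0, Real.zero_rpow (by norm_num), Real.zero_rpow (by positivity)]
      · exact Real.rpow_le_rpow_of_exponent_ge h0 hx (by push_cast; linarith)
    have : 0 ≤ |x| ^ 3 := by positivity
    simp [Nat.factorial]
    nlinarith
  · have h2 : |x| ^ 2 ≤ |x| ^ (2 + γ) := by
      rw [← Real.rpow_natCast]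
      exact Real.rpow_le_rpow_of_exponent_le hx (by push_cast; linarith)
    have : ‖Complex.exp (x * Complex.I) - (1 + x * Complex.I - (x : ℂ) ^ 2 / 2)‖
        ≤ 1 + (1 + |x| + |x| ^ 2 / 2) := by
      refine (norm_sub_le _ _).trans (add_le_add (by simp [Complex.norm_exp_ofReal_mul_I]) ?_)
      refine (norm_sub_le _ _).trans (add_le_add ((norm_add_le _ _).trans (by simp)) (by simp))
    nlinarith

/-- Follows from `1 - b ≤ e^{-b} ≤ 1/(1+b) ≤ 1 - b + b²`. -/
lemma abs_one_sub_sub_exp_neg_le {b : ℝ} (hb : 0 ≤ b) :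
    |1 - b - Real.exp (-b)| ≤ b ^ 2 := by
  have h1 : 1 - b ≤ Real.exp (-b) := by linarith [Real.add_one_le_exp (-b)]
  rw [abs_of_nonpos (by linarith)]
  have h2 : Real.exp (-b) ≤ 1 / (1 + b) := by
    rw [Real.exp_neg, ← one_div]
    exact one_div_le_one_div_of_le (by positivity) (by linarith [Real.add_one_le_exp b])
  have h3 : 1 / (1 + b) ≤ 1 - b + b ^ 2 := by
    rw [div_le_iff₀ (by positivity)]
    nlinarith [pow_nonneg hb 3]
  linarith

/-! ### Characteristic functions of martingale transforms -/

section OneStep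

variable {Ω : Type*} {m m0 : MeasurableSpace Ω} {μ : Measure Ω}

/-- Pull-out property of the Lebesgue conditional expectation. -/
lemma lintegral_mul_condLExp (hm : m ≤ m0) [SigmaFinite (μ.trim hm)] {f g : Ω → ℝ≥0∞}
    (hf : Measurable f) (hg : Measurable[m] g) :
    ∫⁻ ω, g ω * condLExp m μ f ω ∂μ = ∫⁻ ω, g ω * f ω ∂μ := by
  -- The measures with densities `f` and `condLExp m μ f` agree on `m`, and `g` only sees `m`.
  have key : (μ.withDensity (condLExp m μ f)).trim hm = (μ.withDensity f).trim hm := by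
    refine @Measure.ext _ m _ _ fun s hs => ?_
    rw [trim_measurableSet_eq hm hs, trim_measurableSet_eq hm hs, withDensity_apply _ (hm s hs),
      withDensity_apply _ (hm s hs), setLIntegral_condLExp hm _ _ hs]
  have h : ∀ h : Ω → ℝ≥0∞, Measurable h →
      ∫⁻ ω, g ω * h ω ∂μ = ∫⁻ ω, g ω ∂((μ.withDensity h).trim hm) := fun h hh => by
    rw [lintegral_trim hm hg, lintegral_withDensity_eq_lintegral_mul _ hh (hg.mono hm le_rfl)]
    simp [mul_comm]
  rw [h _ (measurable_condLExp' m μ f), h _ hf, key]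

/-- Pull-out property for a bounded complex factor. -/
lemma integral_mul_ofReal_eq_of_condExp (hm : m ≤ m0) [IsFiniteMeasure μ] {G : Ω → ℂ}
    {ξ h : Ω → ℝ} (hG : Measurable[m] G) {B : ℝ} (hGB : ∀ ω, ‖G ω‖ ≤ B) (hξ : Integrable ξ μ)
    (hh : μ[ξ | m] =ᵐ[μ] h) :
    ∫ ω, G ω * (ξ ω : ℂ) ∂μ = ∫ ω, G ω * (h ω : ℂ) ∂μ := by
  have := condExp_stronglyMeasurable_bilin_of_bound
    (B := (ContinuousLinearMap.lsmul ℝ ℝ (E := ℂ)).flip) hm hG.stronglyMeasurable hξ B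
    (ae_of_all _ hGB)
  rw [← integral_condExp (f := fun ω => G ω * (ξ ω : ℂ)) hm]
  refine integral_congr_ae ?_
  have e : (fun ω => G ω * (ξ ω : ℂ)) = fun ω =>
      ((ContinuousLinearMap.lsmul ℝ ℝ (E := ℂ)).flip (G ω)) (ξ ω) := by
    ext ω
    simp [mul_comm]
  rw [e]
  filter_upwards [this, hh] with ω h1 h2
  rw [h1, h2]
  simp [mul_comm]

/-- Two powers of `|a|` are kept so that the bounds can be summed over time; the remaining `γ`
powers supply the small factor `ρ ^ γ`. The moment bound is needed only where `a ≠ 0`, which is what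
permits truncation. Working in `ℝ≥0∞` matters: `|ξ|^(2+δ)` may have infinite mean. -/
lemma lintegral_abs_mul_rpow_le [IsProbabilityMeasure μ] (hm : m ≤ m0)
    {a ξ : Ω → ℝ} {ρ δ γ : ℝ} {K : NNReal} (hγ₀ : 0 < γ) (hγδ : γ ≤ δ)
    (ha : Measurable[m] a) (hξ : Measurable ξ) (haρ : ∀ ω, |a ω| ≤ ρ)
    (haK : ∀ ω, a ω ≠ 0 →
      condLExp m μ (fun ω' => ENNReal.ofReal (|ξ ω'| ^ (2 + δ))) ω ≤ K) :
    ∫⁻ ω, ENNReal.ofReal (|a ω * ξ ω| ^ (2 + γ)) ∂μ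
      ≤ ENNReal.ofReal (ρ ^ γ * (1 + K)) * ∫⁻ ω, ENNReal.ofReal (a ω ^ 2) ∂μ := by
  set f : Ω → ℝ≥0∞ := fun ω' => ENNReal.ofReal (|ξ ω'| ^ (2 + δ))
  have hf : Measurable f := by fun_prop
  have hg : Measurable[m] fun ω => ENNReal.ofReal (|a ω| ^ (2 + γ)) := by
    fun_prop
  have hρ : 0 ≤ ρ := by
    obtain ⟨ω⟩ : Nonempty Ω := nonempty_of_isProbabilityMeasure μ
    exact (abs_nonneg _).trans (haρ ω)
  have hpow : ∀ ω, |a ω| ^ (2 + γ) ≤ ρ ^ γ * a ω ^ 2 := fun ω => by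
    rcases eq_or_ne (a ω) 0 with h0 | h0
    · simp [h0, Real.zero_rpow (by positivity : 2 + γ ≠ 0)]
    · rw [Real.rpow_add (abs_pos.2 h0), mul_comm, Real.rpow_two, sq_abs]
      gcongr
      exact haρ ω
  calc ∫⁻ ω, ENNReal.ofReal (|a ω * ξ ω| ^ (2 + γ)) ∂μ
      ≤ ∫⁻ ω, (ENNReal.ofReal (|a ω| ^ (2 + γ))
          + ENNReal.ofReal (|a ω| ^ (2 + γ)) * f ω) ∂μ := by
        refine lintegral_mono fun ω => ?_
        simp only [f]
        rw [← ENNReal.ofReal_mul (by positivity), ← ENNReal.ofReal_add (by positivity)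
          (by positivity), abs_mul, Real.mul_rpow (abs_nonneg _) (abs_nonneg _)]
        refine ENNReal.ofReal_le_ofReal ?_
        have : |ξ ω| ^ (2 + γ) ≤ 1 + |ξ ω| ^ (2 + δ) := by
          rcases le_total |ξ ω| 1 with h | h
          · have := Real.rpow_le_one (abs_nonneg (ξ ω)) h (by positivity : 0 ≤ 2 + γ)
            have : 0 ≤ |ξ ω| ^ (2 + δ) := by positivity
            linarith
          · have := Real.rpow_le_rpow_of_exponent_le h (by linarith : 2 + γ ≤ 2 + δ)
            linarith
        have h2 : 0 ≤ |a ω| ^ (2 + γ) := by positivity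
        nlinarith
    _ = ∫⁻ ω, (ENNReal.ofReal (|a ω| ^ (2 + γ))
          + ENNReal.ofReal (|a ω| ^ (2 + γ)) * condLExp m μ f ω) ∂μ := by
        rw [lintegral_add_left (hg.mono hm le_rfl), lintegral_add_left (hg.mono hm le_rfl),
          lintegral_mul_condLExp hm hf hg]
    _ ≤ ∫⁻ ω, ENNReal.ofReal (ρ ^ γ * (1 + K)) * ENNReal.ofReal (a ω ^ 2) ∂μ := by
        refine lintegral_mono fun ω => ?_
        rcases eq_or_ne (a ω) 0 with h0 | h0
        · simp [h0, Real.zero_rpow (by positivity : 2 + γ ≠ 0)]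
        · calc _ ≤ ENNReal.ofReal (|a ω| ^ (2 + γ))
                + ENNReal.ofReal (|a ω| ^ (2 + γ)) * K := by
                gcongr
                exact haK ω h0
            _ = ENNReal.ofReal (|a ω| ^ (2 + γ) * (1 + K)) := by
                rw [ENNReal.ofReal_mul (by positivity), ENNReal.ofReal_add (by positivity)
                  (by positivity), mul_add]
                simp
            _ ≤ ENNReal.ofReal (ρ ^ γ * a ω ^ 2 * (1 + K)) := by
                gcongr
                exact hpow ω
            _ = _ := by
                rw [← ENNReal.ofReal_mul (by positivity)]
                ring_nf
    _ = _ := lintegral_const_mul _ (by have := ha.mono hm le_rfl; fun_prop)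

/-- One step of the telescoping argument for characteristic functions of martingales. -/
lemma norm_integral_mul_exp_sub_exp_le [IsProbabilityMeasure μ] (hm : m ≤ m0) {G : Ω → ℂ}
    {a ξ : Ω → ℝ} {B ρ δ γ : ℝ} {K : NNReal} (hγ₀ : 0 < γ) (hγ₁ : γ ≤ 1) (hγδ : γ ≤ δ)
    (hG : Measurable[m] G) (hGB : ∀ ω, ‖G ω‖ ≤ B) (ha : Measurable[m] a) (hξ : Measurable ξ)
    (hξ2 : MemLp ξ 2 μ) (hmean : μ[ξ | m] =ᵐ[μ] 0)
    (hvar : μ[fun ω => ξ ω ^ 2 | m] =ᵐ[μ] fun _ => 1) (haρ : ∀ ω, |a ω| ≤ ρ)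
    (haK : ∀ ω, a ω ≠ 0 →
      condLExp m μ (fun ω' => ENNReal.ofReal (|ξ ω'| ^ (2 + δ))) ω ≤ K) :
    ‖∫ ω, G ω * (Complex.exp ((a ω * ξ ω : ℝ) * Complex.I) - Real.exp (-(a ω ^ 2 / 2))) ∂μ‖
      ≤ B * (4 * (ρ ^ γ * (1 + K)) + ρ ^ 2) * ∫ ω, a ω ^ 2 ∂μ := by
  have ha0 : Measurable a := ha.mono hm le_rfl
  have hG0 : Measurable G := hG.mono hm le_rfl
  obtain ⟨ω₀⟩ : Nonempty Ω := nonempty_of_isProbabilityMeasure μ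
  have hρ : 0 ≤ ρ := (abs_nonneg _).trans (haρ ω₀)
  have hB : 0 ≤ B := (norm_nonneg _).trans (hGB ω₀)
  have ha2 : ∀ ω, a ω ^ 2 ≤ ρ ^ 2 := fun ω => sq_le_sq' (abs_le.1 (haρ ω)).1 (abs_le.1 (haρ ω)).2
  have hξi : Integrable ξ μ := hξ2.integrable (by norm_num)
  have hξ2i : Integrable (fun ω => ξ ω ^ 2) μ := hξ2.integrable_sq
  have ha2i : Integrable (fun ω => a ω ^ 2) μ :=
    .of_bound (by fun_prop) (ρ ^ 2) (ae_of_all _ fun ω => by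
      rw [Real.norm_of_nonneg (sq_nonneg _)]; exact ha2 ω)
  -- first and second order terms
  have h1 : ∫ ω, G ω * a ω * (ξ ω : ℂ) ∂μ = 0 := by
    rw [integral_mul_ofReal_eq_of_condExp hm (B := B * ρ) (by fun_prop) (fun ω => ?_) hξi hmean]
    · simp
    · rw [norm_mul, Complex.norm_real]
      exact mul_le_mul (hGB ω) (haρ ω) (norm_nonneg _) hB
  have hGa : ∀ ω, ‖G ω * (a ω : ℂ) ^ 2‖ ≤ B * ρ ^ 2 := fun ω => by
    rw [norm_mul, norm_pow, Complex.norm_real, Real.norm_eq_abs, sq_abs]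
    exact mul_le_mul (hGB ω) (ha2 ω) (sq_nonneg _) hB
  have h2 : ∫ ω, G ω * (a ω : ℂ) ^ 2 * ((ξ ω ^ 2 : ℝ) : ℂ) ∂μ = ∫ ω, G ω * (a ω : ℂ) ^ 2 ∂μ := by
    rw [integral_mul_ofReal_eq_of_condExp hm (B := B * ρ ^ 2) (by fun_prop) hGa hξ2i hvar]
    simp
  have i1 : Integrable (fun ω => G ω * a ω * (ξ ω : ℂ)) μ := by
    refine hξi.ofReal.bdd_mul (c := B * ρ) (by fun_prop) (ae_of_all _ fun ω => ?_)
    rw [norm_mul, Complex.norm_real]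
    exact mul_le_mul (hGB ω) (haρ ω) (norm_nonneg _) hB
  have i2 : Integrable (fun ω => G ω * (a ω : ℂ) ^ 2 * ((ξ ω ^ 2 : ℝ) : ℂ)) μ :=
    hξ2i.ofReal.bdd_mul (c := B * ρ ^ 2) (by fun_prop) (ae_of_all _ hGa)
  have i3 : Integrable (fun ω => G ω * (a ω : ℂ) ^ 2) μ :=
    .of_bound (by fun_prop) _ (ae_of_all _ hGa)
  -- the remainder
  set R : Ω → ℂ := fun ω => Complex.exp ((a ω * ξ ω : ℝ) * Complex.I)
    - (1 + (a ω * ξ ω : ℝ) * Complex.I - ((a ω * ξ ω : ℝ) : ℂ) ^ 2 / 2) with hR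
  set T : Ω → ℝ := fun ω => 1 - a ω ^ 2 / 2 - Real.exp (-(a ω ^ 2 / 2)) with hT
  have hRm : Measurable R := by fun_prop
  have hTm : Measurable T := by fun_prop
  have hTb : ∀ ω, |T ω| ≤ ρ ^ 2 * a ω ^ 2 := fun ω => by
    refine (abs_one_sub_sub_exp_neg_le (by positivity : 0 ≤ a ω ^ 2 / 2)).trans ?_
    nlinarith [ha2 ω, sq_nonneg (a ω)]
  have hRl : ∫⁻ ω, ‖G ω * R ω‖ₑ ∂μ
      ≤ ENNReal.ofReal (B * (4 * (ρ ^ γ * (1 + K))) * ∫ ω, a ω ^ 2 ∂μ) := by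
    calc ∫⁻ ω, ‖G ω * R ω‖ₑ ∂μ
        ≤ ∫⁻ ω, ENNReal.ofReal (B * 4) * ENNReal.ofReal (|a ω * ξ ω| ^ (2 + γ)) ∂μ := by
          refine lintegral_mono fun ω => ?_
          rw [← ofReal_norm, ← ENNReal.ofReal_mul (by positivity)]
          refine ENNReal.ofReal_le_ofReal ?_
          rw [norm_mul, mul_assoc]
          exact mul_le_mul (hGB ω) (norm_exp_mul_I_sub_taylor_le hγ₀.le hγ₁ _) (norm_nonneg _) hB
      _ = ENNReal.ofReal (B * 4) * ∫⁻ ω, ENNReal.ofReal (|a ω * ξ ω| ^ (2 + γ)) ∂μ :=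
          lintegral_const_mul _ (by fun_prop)
      _ ≤ ENNReal.ofReal (B * 4) * (ENNReal.ofReal (ρ ^ γ * (1 + K))
            * ∫⁻ ω, ENNReal.ofReal (a ω ^ 2) ∂μ) := by
          gcongr
          exact lintegral_abs_mul_rpow_le hm hγ₀ hγδ ha hξ haρ haK
      _ = _ := by
          rw [← ofReal_integral_eq_lintegral_ofReal ha2i (ae_of_all _ fun ω => sq_nonneg _),
            ← ENNReal.ofReal_mul (by positivity), ← ENNReal.ofReal_mul (by positivity)]
          ring_nf
  have iR : Integrable (fun ω => G ω * R ω) μ :=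
    ⟨by fun_prop, hRl.trans_lt ENNReal.ofReal_lt_top⟩
  have iT : Integrable (fun ω => G ω * (T ω : ℂ)) μ := by
    refine .of_bound (by fun_prop) (B * (ρ ^ 2 * ρ ^ 2)) (ae_of_all _ fun ω => ?_)
    rw [norm_mul, Complex.norm_real]
    refine mul_le_mul (hGB ω) ((hTb ω).trans ?_) (norm_nonneg _) hB
    exact mul_le_mul_of_nonneg_left (ha2 ω) (sq_nonneg ρ)
  -- Conditional variance one matches the quadratic term of `exp(i a ξ)` with that of `exp(-a²/2)`,
  -- and conditional mean zero kills the linear term. Only the remainders `R` and `T` survive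
  -- integration.
  have split : ∀ ω, G ω * (Complex.exp ((a ω * ξ ω : ℝ) * Complex.I) - Real.exp (-(a ω ^ 2 / 2)))
      = G ω * R ω + G ω * (T ω : ℂ) + Complex.I * (G ω * a ω * (ξ ω : ℂ))
        + (1 / 2 : ℂ) * (G ω * (a ω : ℂ) ^ 2 - G ω * (a ω : ℂ) ^ 2 * ((ξ ω ^ 2 : ℝ) : ℂ)) := by
    intro ω
    simp only [hR, hT]
    push_cast
    ring
  simp_rw [split]
  have j1 : Integrable (fun ω => G ω * R ω + G ω * (T ω : ℂ)) μ := iR.add iT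
  have j2 : Integrable (fun ω => Complex.I * (G ω * a ω * (ξ ω : ℂ))) μ := i1.const_mul _
  have j3 : Integrable (fun ω => G ω * R ω + G ω * (T ω : ℂ)
      + Complex.I * (G ω * a ω * (ξ ω : ℂ))) μ := j1.add j2
  have j4 : Integrable (fun ω => (1 / 2 : ℂ) *
      (G ω * (a ω : ℂ) ^ 2 - G ω * (a ω : ℂ) ^ 2 * ((ξ ω ^ 2 : ℝ) : ℂ))) μ :=
    (i3.sub i2).const_mul _
  rw [integral_add j3 j4, integral_add j1 j2, integral_add iR iT, integral_const_mul,
    integral_const_mul, integral_sub i3 i2, h1, h2]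
  simp only [mul_zero, sub_self, add_zero]
  refine (norm_add_le _ _).trans ?_
  have bR : ‖∫ ω, G ω * R ω ∂μ‖ ≤ B * (4 * (ρ ^ γ * (1 + K))) * ∫ ω, a ω ^ 2 ∂μ := by
    refine (norm_integral_le_integral_norm _).trans ?_
    rw [integral_norm_eq_lintegral_enorm iR.1]
    refine ENNReal.toReal_le_of_le_ofReal ?_ hRl
    have : 0 ≤ ∫ ω, a ω ^ 2 ∂μ := integral_nonneg fun ω => sq_nonneg _
    positivity
  have bT : ‖∫ ω, G ω * (T ω : ℂ) ∂μ‖ ≤ B * ρ ^ 2 * ∫ ω, a ω ^ 2 ∂μ := by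
    rw [← integral_const_mul]
    refine norm_integral_le_of_norm_le (ha2i.const_mul _) (ae_of_all _ fun ω => ?_)
    rw [norm_mul, Complex.norm_real, mul_assoc]
    exact mul_le_mul (hGB ω) (hTb ω) (norm_nonneg _) hB
  calc _ ≤ _ := add_le_add bR bT
    _ = _ := by ring

end OneStep

/-- Quantitative characteristic function bound for a martingale transform `∑ a_s ξ_s` with
predictable coefficients, normalised by its conditional variance `∑ a_s²`. -/
lemma norm_integral_exp_sum_sub_one_le {Ω : Type*} {m0 : MeasurableSpace Ω} {μ : Measure Ω}
    [IsProbabilityMeasure μ] (ℱ : Filtration ℕ m0) (n : ℕ) {a ξ : ℕ → Ω → ℝ} {c ρ δ γ : ℝ}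
    {K : NNReal} (hγ₀ : 0 < γ) (hγ₁ : γ ≤ 1) (hγδ : γ ≤ δ)
    (ha : ∀ s < n, Measurable[ℱ s] (a s)) (hξ : ∀ s < n, Measurable (ξ s))
    (hξa : ∀ s, s + 1 < n → Measurable[ℱ (s + 1)] (ξ s))
    (hξ2 : ∀ s < n, MemLp (ξ s) 2 μ) (hmean : ∀ s < n, μ[ξ s | ℱ s] =ᵐ[μ] 0)
    (hvar : ∀ s < n, μ[fun ω => ξ s ω ^ 2 | ℱ s] =ᵐ[μ] fun _ => 1)
    (haρ : ∀ s < n, ∀ ω, |a s ω| ≤ ρ)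
    (haK : ∀ s < n, ∀ ω, a s ω ≠ 0 →
      condLExp (ℱ s) μ (fun ω' => ENNReal.ofReal (|ξ s ω'| ^ (2 + δ))) ω ≤ K)
    (hc : ∀ ω, ∑ s ∈ Finset.range n, a s ω ^ 2 ≤ c) (hρ : 0 ≤ ρ) :
    ‖∫ ω, Complex.exp ((∑ s ∈ Finset.range n, a s ω * ξ s ω : ℝ) * Complex.I)
        * Real.exp ((∑ s ∈ Finset.range n, a s ω ^ 2) / 2) ∂μ - 1‖
      ≤ Real.exp (c / 2) * (4 * (ρ ^ γ * (1 + K)) + ρ ^ 2) * c := by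
  set N : ℕ → Ω → ℂ := fun k ω =>
    Complex.exp ((∑ s ∈ Finset.range k, a s ω * ξ s ω : ℝ) * Complex.I)
        * Real.exp ((∑ s ∈ Finset.range k, a s ω ^ 2) / 2) with hN
  set C := Real.exp (c / 2) * (4 * (ρ ^ γ * (1 + K)) + ρ ^ 2)
  have hC : 0 ≤ C := by positivity
  have hQ : ∀ k ≤ n, ∀ ω, ∑ s ∈ Finset.range k, a s ω ^ 2 ≤ c := fun k hk ω =>
    (Finset.sum_le_sum_of_subset_of_nonneg (Finset.range_mono hk)
      fun _ _ _ => sq_nonneg _).trans (hc ω)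
  have ha0 : ∀ s < n, Measurable (a s) := fun s hs => (ha s hs).mono (ℱ.le s) le_rfl
  have hNnorm : ∀ k ω, ‖N k ω‖ = Real.exp ((∑ s ∈ Finset.range k, a s ω ^ 2) / 2) := fun k ω => by
    simp only [hN]
    rw [norm_mul, Complex.norm_exp_ofReal_mul_I, one_mul, Complex.norm_real,
      Real.norm_of_nonneg (Real.exp_pos _).le]
  have hNm0 : ∀ k ≤ n, Measurable (N k) := fun k hk => by
    have h1 : Measurable fun ω => ∑ s ∈ Finset.range k, a s ω * ξ s ω :=
      Finset.measurable_fun_sum _ fun s hs => by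
        have hs := (Finset.mem_range.1 hs).trans_le hk
        exact (ha0 s hs).mul (hξ s hs)
    have h2 : Measurable fun ω => ∑ s ∈ Finset.range k, a s ω ^ 2 :=
      Finset.measurable_fun_sum _ fun s hs =>
        (ha0 s ((Finset.mem_range.1 hs).trans_le hk)).pow_const 2
    fun_prop
  have hNi : ∀ k ≤ n, Integrable (N k) μ := fun k hk =>
    .of_bound (hNm0 k hk).aestronglyMeasurable (Real.exp (c / 2)) (ae_of_all _ fun ω => by
      rw [hNnorm]
      have := hQ k hk ω
      gcongr)
  -- `N k` involves `ξ s` only for `s < k < n`, so the last noise variable is never required to be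
  -- adapted.
  have hNm : ∀ k < n, Measurable[ℱ k] (N k) := fun k hk => by
    have h1 : Measurable[ℱ k] fun ω => ∑ s ∈ Finset.range k, a s ω * ξ s ω :=
      Finset.measurable_fun_sum _ fun s hs => by
        have hs := Finset.mem_range.1 hs
        exact ((ha s (hs.trans hk)).mono (ℱ.mono hs.le) le_rfl).mul
          ((hξa s (by omega)).mono (ℱ.mono hs) le_rfl)
    have h2 : Measurable[ℱ k] fun ω => ∑ s ∈ Finset.range k, a s ω ^ 2 :=
      Finset.measurable_fun_sum _ fun s hs => by
        have hs := Finset.mem_range.1 hs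
        exact ((ha s (hs.trans hk)).mono (ℱ.mono hs.le) le_rfl).pow_const 2
    fun_prop
  have step : ∀ k < n, ‖∫ ω, N (k + 1) ω ∂μ - ∫ ω, N k ω ∂μ‖ ≤ C * ∫ ω, a k ω ^ 2 ∂μ := by
    intro k hk
    rw [← integral_sub (hNi _ hk) (hNi _ hk.le)]
    -- The prefactor is `ℱ k`-measurable, and its norm `exp(Q_{k+1}/2)` is at most `exp(c/2)` by the
    -- everywhere bound on `Q`.
    have e : ∀ ω, N (k + 1) ω - N k ω = (N k ω * (Real.exp (a k ω ^ 2 / 2) : ℂ)) *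
        (Complex.exp ((a k ω * ξ k ω : ℝ) * Complex.I) - Real.exp (-(a k ω ^ 2 / 2))) := by
      intro ω
      have e1 : (Real.exp (a k ω ^ 2 / 2) : ℂ) * Real.exp (-(a k ω ^ 2 / 2)) = 1 := by
        rw [← Complex.ofReal_mul, ← Real.exp_add]
        simp
      have e2 : N (k + 1) ω = N k ω * (Real.exp (a k ω ^ 2 / 2) : ℂ)
          * Complex.exp ((a k ω * ξ k ω : ℝ) * Complex.I) := by
        simp only [hN, Finset.sum_range_succ, add_div, Real.exp_add, Complex.ofReal_add,
          Complex.ofReal_mul, add_mul, Complex.exp_add]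
        ring
      rw [e2, mul_sub, mul_assoc (N k ω) _ ((Real.exp (-(a k ω ^ 2 / 2)) : ℝ) : ℂ), e1, mul_one]
    simp_rw [e]
    refine norm_integral_mul_exp_sub_exp_le (ℱ.le k) hγ₀ hγ₁ hγδ ?_ (fun ω => ?_) (ha k hk)
      (hξ k hk) (hξ2 k hk) (hmean k hk) (hvar k hk) (haρ k hk) (haK k hk)
    · have := ha k hk
      have := hNm k hk
      fun_prop
    · rw [norm_mul, hNnorm, Complex.norm_real, Real.norm_of_nonneg (Real.exp_pos _).le,
        ← Real.exp_add, ← add_div, ← Finset.sum_range_succ (fun s => a s ω ^ 2)]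
      have := hQ (k + 1) hk ω
      gcongr
  have tele : ∀ k ≤ n, ‖∫ ω, N k ω ∂μ - 1‖ ≤ C * ∑ s ∈ Finset.range k, ∫ ω, a s ω ^ 2 ∂μ := by
    intro k
    induction k with
    | zero => intro _; simp [hN]
    | succ k ih =>
      intro hk
      rw [Finset.sum_range_succ, mul_add]
      calc _ = ‖(∫ ω, N k ω ∂μ - 1) + (∫ ω, N (k + 1) ω ∂μ - ∫ ω, N k ω ∂μ)‖ := by
            congr 1; ring
        _ ≤ _ := (norm_add_le _ _).trans (add_le_add (ih (by omega)) (step k hk))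
  -- The expected squares add up to at most `c`, so the error does not grow with `n`.
  refine (tele n le_rfl).trans ?_
  gcongr
  rw [← integral_finsetSum]
  · calc _ ≤ ∫ _, c ∂μ := integral_mono_of_nonneg
          (ae_of_all _ fun ω => Finset.sum_nonneg fun _ _ => sq_nonneg _)
          (integrable_const _) (ae_of_all _ hc)
      _ = c := by simp
  · intro s hs
    have hs := Finset.mem_range.1 hs
    refine .of_bound ((ha0 s hs).pow_const 2).aestronglyMeasurable (ρ ^ 2)
      (ae_of_all _ fun ω => ?_)
    rw [Real.norm_of_nonneg (sq_nonneg _), ← sq_abs]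
    have := haρ s hs ω
    gcongr

/-! ### Linear algebra of the weights -/

section DesignAlgebra

open Matrix

variable {d : ℕ}

lemma posSemidef_vecMulVec_self (v : Fin d → ℝ) : (vecMulVec v v).PosSemidef := by
  simpa using posSemidef_vecMulVec_self_star v

lemma lambdaMin_mul_dotProduct_le {A : Matrix (Fin d) (Fin d) ℝ} (hA : A.IsHermitian)
    (v : Fin d → ℝ) : lambdaMin A * (v ⬝ᵥ v) ≤ v ⬝ᵥ A *ᵥ v := by
  have h : algebraMap ℝ (Matrix (Fin d) (Fin d) ℝ) (lambdaMin A) ≤ A := by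
    rw [algebraMap_le_iff_le_spectrum (ha := hA.isSelfAdjoint)]
    exact fun x hx => csInf_le (Matrix.finite_real_spectrum (A := A)).bddBelow hx
  have := (Matrix.le_iff.1 h).dotProduct_mulVec_nonneg v
  rw [Algebra.algebraMap_eq_smul_one] at this
  simp only [star_trivial, sub_mulVec, smul_mulVec, one_mulVec, dotProduct_sub,
    dotProduct_smul, smul_eq_mul] at this
  linarith

/-- With `v = A⁻¹ u`, expand `‖u - L v‖² ≥ 0` and use `L ‖v‖² ≤ vᵀ A v = u ⬝ᵥ v`. -/
lemma dotProduct_inv_mulVec_le {A : Matrix (Fin d) (Fin d) ℝ} (hA : A.PosDef) {L : ℝ} (hL : 0 < L)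
    (hLA : L ≤ lambdaMin A) (u : Fin d → ℝ) : u ⬝ᵥ A⁻¹ *ᵥ u ≤ (u ⬝ᵥ u) / L := by
  set v := A⁻¹ *ᵥ u
  have hu : A *ᵥ v = u := by
    rw [mulVec_mulVec, Matrix.mul_nonsing_inv _ ((isUnit_iff_isUnit_det _).1 hA.isUnit),
      one_mulVec]
  have h1 := lambdaMin_mul_dotProduct_le hA.isHermitian v
  rw [hu, dotProduct_comm v u] at h1
  have h2 : 0 ≤ v ⬝ᵥ v := by simpa using dotProduct_star_self_nonneg v
  have h3 : 0 ≤ (u - L • v) ⬝ᵥ (u - L • v) := by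
    simpa using dotProduct_star_self_nonneg (u - L • v)
  simp only [dotProduct_sub, sub_dotProduct, dotProduct_smul, smul_dotProduct, smul_eq_mul,
    dotProduct_comm v u] at h3
  have h4 : L * (v ⬝ᵥ v) ≤ u ⬝ᵥ v := (mul_le_mul_of_nonneg_right hLA h2).trans h1
  rw [le_div_iff₀ hL]
  nlinarith

lemma inner_eq_dotProduct_ofLp (u v : EuclideanSpace ℝ (Fin d)) :
    inner ℝ u v = u.ofLp ⬝ᵥ v.ofLp := by
  rw [EuclideanSpace.inner_eq_star_dotProduct, dotProduct_comm]
  simp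

lemma norm_sq_eq_dotProduct_ofLp (u : EuclideanSpace ℝ (Fin d)) :
    ‖u‖ ^ 2 = u.ofLp ⬝ᵥ u.ofLp := by
  rw [← real_inner_self_eq_norm_sq, inner_eq_dotProduct_ofLp]

section Weights

variable {S₀ : Matrix (Fin d) (Fin d) ℝ} (x : ℕ → EuclideanSpace ℝ (Fin d))

lemma posDef_sigmaMat (hS : S₀.PosDef) (t : ℕ) : (sigmaMat S₀ x t).PosDef :=
  hS.add_posSemidef (posSemidef_sum _ fun _ _ => posSemidef_vecMulVec_self _)

variable (S₀) in
lemma posDef_one_add_sum_zVec (t : ℕ) :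
    (1 + ∑ i ∈ Finset.Icc 1 t, vecMulVec (zVec S₀ x i).ofLp (zVec S₀ x i).ofLp).PosDef :=
  PosDef.one.add_posSemidef (posSemidef_sum _ fun _ _ => posSemidef_vecMulVec_self _)

variable (S₀) in
lemma posDef_variabilityMat (t : ℕ) : (variabilityMat S₀ x t).PosDef :=
  (posDef_one_add_sum_zVec S₀ x t).inv

variable (S₀) in
lemma inv_variabilityMat (t : ℕ) : (variabilityMat S₀ x t)⁻¹
    = 1 + ∑ i ∈ Finset.Icc 1 t, vecMulVec (zVec S₀ x i).ofLp (zVec S₀ x i).ofLp :=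
  nonsing_inv_nonsing_inv _ ((isUnit_iff_isUnit_det _).1 (posDef_one_add_sum_zVec S₀ x t).isUnit)

lemma ofLp_weight (t : ℕ) : (weight S₀ x t).ofLp
    = √(1 + (zVec S₀ x t).ofLp ⬝ᵥ variabilityMat S₀ x (t - 1) *ᵥ (zVec S₀ x t).ofLp)
      • variabilityMat S₀ x t *ᵥ (zVec S₀ x t).ofLp := by
  simp [weight, inner_eq_dotProduct_ofLp]

variable (S₀) in
lemma inv_variabilityMat_succ (t : ℕ) : (variabilityMat S₀ x (t + 1))⁻¹
    = (variabilityMat S₀ x t)⁻¹ + vecMulVec (zVec S₀ x (t + 1)).ofLp (zVec S₀ x (t + 1)).ofLp := by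
  rw [inv_variabilityMat, inv_variabilityMat, Finset.sum_Icc_succ_top (by omega), add_assoc]

variable (S₀) in
/-- Sherman–Morrison for the variability matrix, applied to `z_{t+1}`. -/
lemma one_add_smul_variabilityMat_succ_mulVec (t : ℕ) :
    (1 + (zVec S₀ x (t + 1)).ofLp ⬝ᵥ variabilityMat S₀ x t *ᵥ (zVec S₀ x (t + 1)).ofLp)
        • variabilityMat S₀ x (t + 1) *ᵥ (zVec S₀ x (t + 1)).ofLp
      = variabilityMat S₀ x t *ᵥ (zVec S₀ x (t + 1)).ofLp := by
  set V := variabilityMat S₀ x t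
  set V' := variabilityMat S₀ x (t + 1)
  set z := (zVec S₀ x (t + 1)).ofLp
  have hV : IsUnit V.det := (isUnit_iff_isUnit_det _).1 (posDef_variabilityMat S₀ x t).isUnit
  have hV' : IsUnit V'.det :=
    (isUnit_iff_isUnit_det _).1 (posDef_variabilityMat S₀ x (t + 1)).isUnit
  have h : V'⁻¹ *ᵥ (V *ᵥ z) = (1 + z ⬝ᵥ V *ᵥ z) • z := by
    rw [inv_variabilityMat_succ, add_mulVec, mulVec_mulVec, nonsing_inv_mul _ hV, one_mulVec,
      vecMulVec_mulVec]
    ext i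
    simp [add_mul, V, z]
  rw [← mulVec_smul, ← h, mulVec_mulVec, mul_nonsing_inv _ hV', one_mulVec]

lemma one_add_dotProduct_pos (t s : ℕ) :
    0 < 1 + (zVec S₀ x s).ofLp ⬝ᵥ variabilityMat S₀ x t *ᵥ (zVec S₀ x s).ofLp := by
  have := (posDef_variabilityMat S₀ x t).posSemidef.dotProduct_mulVec_nonneg (zVec S₀ x s).ofLp
  simp only [star_trivial] at this
  positivity

/-- The rank-one matrices of the weights telescope: `w_{t+1} w_{t+1}ᵀ = V_t - V_{t+1}`. -/
lemma vecMulVec_weight (t : ℕ) :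
    vecMulVec (weight S₀ x (t + 1)).ofLp (weight S₀ x (t + 1)).ofLp
      = variabilityMat S₀ x t - variabilityMat S₀ x (t + 1) := by
  have hV : IsUnit (variabilityMat S₀ x t).det :=
    (isUnit_iff_isUnit_det _).1 (posDef_variabilityMat S₀ x t).isUnit
  have hV' : IsUnit (variabilityMat S₀ x (t + 1)).det :=
    (isUnit_iff_isUnit_det _).1 (posDef_variabilityMat S₀ x (t + 1)).isUnit
  have hsymm : (variabilityMat S₀ x t)ᵀ = variabilityMat S₀ x t := by
    simpa using (posDef_variabilityMat S₀ x t).isHermitian.eq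
  have hs := one_add_smul_variabilityMat_succ_mulVec S₀ x t
  have hpos := one_add_dotProduct_pos (S₀ := S₀) x t (t + 1)
  have hinv := inv_variabilityMat_succ S₀ x t
  -- The two square roots multiply to `1 + zᵀ V z`, which Sherman–Morrison absorbs by turning one
  -- factor `V' z` into `V z`. This is the purpose of the scalar factor in the weights.
  rw [ofLp_weight, Nat.add_sub_cancel, smul_vecMulVec, vecMulVec_smul, smul_smul,
    Real.mul_self_sqrt hpos.le, ← vecMulVec_smul, hs]
  set V := variabilityMat S₀ x t
  set V' := variabilityMat S₀ x (t + 1)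
  set z := (zVec S₀ x (t + 1)).ofLp
  calc vecMulVec (V' *ᵥ z) (V *ᵥ z) = V' * vecMulVec z z * V := by
        rw [mul_vecMulVec, vecMulVec_mul, ← hsymm, mulVec_transpose, hsymm]
    _ = V' * (V'⁻¹ - V⁻¹) * V := by rw [hinv]; simp
    _ = V - V' := by
        rw [mul_sub, sub_mul, mul_nonsing_inv _ hV', mul_assoc, nonsing_inv_mul _ hV]; simp

lemma variabilityMat_zero : variabilityMat S₀ x 0 = 1 := by simp [variabilityMat]

/-- `∑ ⟨u, w_t⟩² = ‖u‖² - uᵀ V_n u`. -/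
lemma sum_inner_weight_sq (u : EuclideanSpace ℝ (Fin d)) (n : ℕ) :
    ∑ s ∈ Finset.range n, inner ℝ u (weight S₀ x (s + 1)) ^ 2
      = ‖u‖ ^ 2 - u.ofLp ⬝ᵥ variabilityMat S₀ x n *ᵥ u.ofLp := by
  induction n with
  | zero => simp [variabilityMat_zero, norm_sq_eq_dotProduct_ofLp]
  | succ n ih =>
    have h : inner ℝ u (weight S₀ x (n + 1)) ^ 2 = u.ofLp ⬝ᵥ
        vecMulVec (weight S₀ x (n + 1)).ofLp (weight S₀ x (n + 1)).ofLp *ᵥ u.ofLp := by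
      rw [vecMulVec_mulVec, inner_eq_dotProduct_ofLp]
      simp [dotProduct_comm, sq]
    rw [Finset.sum_range_succ, ih, h, vecMulVec_weight, sub_mulVec, dotProduct_sub]
    ring

lemma sum_inner_weight_sq_le (u : EuclideanSpace ℝ (Fin d)) (n : ℕ) :
    ∑ s ∈ Finset.range n, inner ℝ u (weight S₀ x (s + 1)) ^ 2 ≤ ‖u‖ ^ 2 := by
  rw [sum_inner_weight_sq]
  have := (posDef_variabilityMat S₀ x n).posSemidef.dotProduct_mulVec_nonneg u.ofLp
  simp only [star_trivial] at this
  linarith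

lemma le_sum_inner_weight_sq (u : EuclideanSpace ℝ (Fin d)) (n : ℕ) {L : ℝ} (hL : 0 < L)
    (h : L ≤ lambdaMin (variabilityMat S₀ x n)⁻¹) :
    ‖u‖ ^ 2 - ‖u‖ ^ 2 / L ≤ ∑ s ∈ Finset.range n, inner ℝ u (weight S₀ x (s + 1)) ^ 2 := by
  rw [sum_inner_weight_sq, norm_sq_eq_dotProduct_ofLp]
  have := dotProduct_inv_mulVec_le (posDef_variabilityMat S₀ x n).inv hL h u.ofLp
  rw [nonsing_inv_nonsing_inv _
    ((isUnit_iff_isUnit_det _).1 (posDef_variabilityMat S₀ x n).isUnit)] at this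
  linarith

/-- By Sherman–Morrison `w = V z / √(1 + s)` with `V = V_t` and `s = zᵀ V z ≥ 0`, and `V` is a
contraction because `V⁻¹ ≥ I`. -/
lemma norm_weight_le (t : ℕ) : ‖weight S₀ x (t + 1)‖ ≤ ‖zVec S₀ x (t + 1)‖ := by
  have hpos := one_add_dotProduct_pos (S₀ := S₀) x t (t + 1)
  have hnn := (posDef_variabilityMat S₀ x t).posSemidef.dotProduct_mulVec_nonneg
    (zVec S₀ x (t + 1)).ofLp
  simp only [star_trivial] at hnn
  have hs := one_add_smul_variabilityMat_succ_mulVec S₀ x t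
  have hw := ofLp_weight (S₀ := S₀) x (t + 1)
  rw [Nat.add_sub_cancel] at hw
  have hV : IsUnit (variabilityMat S₀ x t).det :=
    (isUnit_iff_isUnit_det _).1 (posDef_variabilityMat S₀ x t).isUnit
  refine le_of_sq_le_sq ?_ (norm_nonneg _)
  rw [norm_sq_eq_dotProduct_ofLp, norm_sq_eq_dotProduct_ofLp, hw]
  set V := variabilityMat S₀ x t with hVdef
  set V' := variabilityMat S₀ x (t + 1)
  set z := (zVec S₀ x (t + 1)).ofLp
  set s := z ⬝ᵥ V *ᵥ z
  have h1 : (1 + s) * ((√(1 + s) • V' *ᵥ z) ⬝ᵥ (√(1 + s) • V' *ᵥ z)) = (V *ᵥ z) ⬝ᵥ (V *ᵥ z) := by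
    rw [← hs]
    simp only [smul_dotProduct, dotProduct_smul, smul_eq_mul]
    rw [← mul_assoc √(1 + s), Real.mul_self_sqrt hpos.le]
  have h2 : (V *ᵥ z) ⬝ᵥ (V *ᵥ z) ≤ s := by
    have hz : V⁻¹ *ᵥ (V *ᵥ z) = z := by rw [mulVec_mulVec, nonsing_inv_mul _ hV, one_mulVec]
    have h3 := (posSemidef_sum (Finset.Icc 1 t) fun i _ =>
      posSemidef_vecMulVec_self (zVec S₀ x i).ofLp).dotProduct_mulVec_nonneg (V *ᵥ z)
    have h4 : (V *ᵥ z) ⬝ᵥ V⁻¹ *ᵥ (V *ᵥ z) = s := by rw [hz, dotProduct_comm]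
    rw [hVdef, inv_variabilityMat, ← hVdef, add_mulVec, one_mulVec, dotProduct_add] at h4
    simp only [star_trivial] at h3
    linarith
  have h3 : 0 ≤ (z - V *ᵥ z) ⬝ᵥ (z - V *ᵥ z) := by
    simpa using dotProduct_star_self_nonneg (z - V *ᵥ z)
  simp only [dotProduct_sub, sub_dotProduct, dotProduct_comm (V *ᵥ z) z] at h3
  have h5 : 0 ≤ (√(1 + s) • V' *ᵥ z) ⬝ᵥ (√(1 + s) • V' *ᵥ z) := by
    simpa using dotProduct_star_self_nonneg (√(1 + s) • V' *ᵥ z)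
  have h6 : 0 ≤ (V *ᵥ z) ⬝ᵥ (V *ᵥ z) := by simpa using dotProduct_star_self_nonneg (V *ᵥ z)
  have h7 : (z - V *ᵥ z) ⬝ᵥ V *ᵥ z = s - (V *ᵥ z) ⬝ᵥ (V *ᵥ z) := by rw [sub_dotProduct]
  have h8 : 0 ≤ z ⬝ᵥ z - 2 * s + (V *ᵥ z) ⬝ᵥ (V *ᵥ z) := by
    change 0 ≤ z ⬝ᵥ z - s - (s - (V *ᵥ z) ⬝ᵥ (V *ᵥ z)) at h3
    linarith
  nlinarith

/-- Since `x_t = Σ_{t-1}^{1/2} z_t`, one has `‖x_t‖² = z_tᵀ Σ_{t-1} z_t ≥ z_tᵀ Σ_0 z_t`. -/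
lemma norm_zVec_sq_le (hS : S₀.PosDef) {L : ℝ} (hL : 0 < L) (hLS : L ≤ lambdaMin S₀) (t : ℕ) :
    ‖zVec S₀ x t‖ ^ 2 ≤ ‖x t‖ ^ 2 / L := by
  have hpd := posDef_sigmaMat x hS (t - 1)
  have hnn : 0 ≤ sigmaMat S₀ x (t - 1) := hpd.posSemidef.nonneg
  set R := CFC.sqrt (sigmaMat S₀ x (t - 1)) with hR
  have hRR : R * R = sigmaMat S₀ x (t - 1) := CFC.sqrt_mul_sqrt_self _ hnn
  have hRs : Rᵀ = R := by
    simpa using ((CFC.sqrt_nonneg (sigmaMat S₀ x (t - 1))).posSemidef).isHermitian.eq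
  have hRu : IsUnit R.det := by
    have h := (isUnit_iff_isUnit_det _).1 hpd.isUnit
    rw [← hRR, det_mul] at h
    exact isUnit_of_mul_isUnit_left h
  have hz : (zVec S₀ x t).ofLp = R⁻¹ *ᵥ (x t).ofLp := by simp [zVec, hR]
  have hx : (x t).ofLp = R *ᵥ (zVec S₀ x t).ofLp := by
    rw [hz, mulVec_mulVec, mul_nonsing_inv _ hRu, one_mulVec]
  rw [norm_sq_eq_dotProduct_ofLp, norm_sq_eq_dotProduct_ofLp, hx, le_div_iff₀ hL]
  set z := (zVec S₀ x t).ofLp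
  have h1 : (R *ᵥ z) ⬝ᵥ (R *ᵥ z) = z ⬝ᵥ sigmaMat S₀ x (t - 1) *ᵥ z := by
    rw [← hRR, ← mulVec_mulVec, dotProduct_mulVec z, ← mulVec_transpose, hRs]
  have h2 := lambdaMin_mul_dotProduct_le hS.isHermitian z
  have h3 := (posSemidef_sum (Finset.Icc 1 (t - 1)) fun i _ =>
      posSemidef_vecMulVec_self (x i).ofLp).dotProduct_mulVec_nonneg z
  have h4 : 0 ≤ z ⬝ᵥ z := by simpa using dotProduct_star_self_nonneg z
  rw [h1, sigmaMat, add_mulVec, dotProduct_add]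
  simp only [star_trivial] at h3
  nlinarith

lemma abs_inner_weight_le (hS : S₀.PosDef) {L : ℝ} (hL : 0 < L) (hLS : L ≤ lambdaMin S₀)
    (u : EuclideanSpace ℝ (Fin d)) (t : ℕ) (hx : ‖x (t + 1)‖ ≤ 1) :
    |inner ℝ u (weight S₀ x (t + 1))| ≤ ‖u‖ / √L := by
  refine (abs_real_inner_le_norm _ _).trans ?_
  rw [div_eq_mul_inv]
  gcongr
  refine (norm_weight_le x t).trans ?_
  rw [← Real.sqrt_inv]
  refine Real.le_sqrt_of_sq_le ((norm_zVec_sq_le x hS hL hLS (t + 1)).trans ?_)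
  rw [div_eq_mul_inv]
  exact mul_le_of_le_one_left (by positivity) (pow_le_one₀ (norm_nonneg _) hx)

end Weights

end DesignAlgebra

/-! ### Measurability of the weights as functions of the data -/

section Measurability

instance instMeasurableSpaceMatrix {m n : Type*} : MeasurableSpace (Matrix m n ℝ) :=
  MeasurableSpace.pi

instance instBorelSpaceMatrix {m n : Type*} [Countable m] [Countable n] :
    BorelSpace (Matrix m n ℝ) :=
  inferInstanceAs (BorelSpace (m → n → ℝ))

variable {d : ℕ} {Ω : Type*} [MeasurableSpace Ω]

lemma measurable_matrix_iff {M : Ω → Matrix (Fin d) (Fin d) ℝ} :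
    Measurable M ↔ ∀ i j, Measurable fun ω => M ω i j :=
  measurable_pi_iff.trans (forall_congr' fun _ => measurable_pi_iff)

/-- Cramer's rule; singular matrices cause no trouble because `0⁻¹ = 0` and real inversion is
measurable everywhere. -/
lemma measurable_matrix_inv {M : Ω → Matrix (Fin d) (Fin d) ℝ} (hM : Measurable M) :
    Measurable fun ω => (M ω)⁻¹ := by
  rw [measurable_matrix_iff]
  intro i j
  simp only [Matrix.inv_def, Ring.inverse_eq_inv', Matrix.smul_apply, smul_eq_mul]
  have h1 : Continuous fun A : Matrix (Fin d) (Fin d) ℝ => A.det := continuous_id.matrix_det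
  have h2 : Continuous fun A : Matrix (Fin d) (Fin d) ℝ => A.adjugate i j :=
    continuous_id.matrix_adjugate.matrix_elem i j
  exact (h1.measurable.comp hM).inv.mul (h2.measurable.comp hM)

open scoped Matrix.Norms.L2Operator in
lemma continuousOn_matrix_sqrt :
    ContinuousOn (CFC.sqrt : Matrix (Fin d) (Fin d) ℝ → Matrix (Fin d) (Fin d) ℝ) {a | 0 ≤ a} :=
  CFC.continuousOn_sqrt

lemma measurable_matrix_sqrt {M : Ω → Matrix (Fin d) (Fin d) ℝ} (hM : Measurable M)
    (hpos : ∀ ω, 0 ≤ M ω) : Measurable fun ω => CFC.sqrt (M ω) := by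
  -- The root is continuous only on the positive semidefinite cone, so `M` is factored through that
  -- subtype.
  have h := continuousOn_iff_continuous_domRestrict.1 (continuousOn_matrix_sqrt (d := d))
  exact h.measurable.comp (hM.subtype_mk (h := hpos))

lemma measurable_toEuclideanCLM_apply {M : Ω → Matrix (Fin d) (Fin d) ℝ}
    {v : Ω → EuclideanSpace ℝ (Fin d)} (hM : Measurable M) (hv : Measurable v) :
    Measurable fun ω => Matrix.toEuclideanCLM (𝕜 := ℝ) (M ω) (v ω) := by
  have h : ∀ ω, Matrix.toEuclideanCLM (𝕜 := ℝ) (M ω) (v ω)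
      = WithLp.toLp 2 (fun i => ∑ j, M ω i j * v ω j) := fun ω => by
    ext i
    simp [Matrix.mulVec, dotProduct]
  simp_rw [h]
  have hM' := measurable_matrix_iff.1 hM
  have hv' : ∀ j, Measurable fun ω => v ω j := fun j => by fun_prop
  refine (WithLp.measurable_toLp 2 _).comp (measurable_pi_iff.2 fun i => ?_)
  exact Finset.measurable_fun_sum _ fun j _ => (hM' i j).mul (hv' j)

lemma measurable_add_sum_vecMulVec {M : Ω → Matrix (Fin d) (Fin d) ℝ} (hM : Measurable M)
    {s : Finset ℕ} {v w : ℕ → Ω → EuclideanSpace ℝ (Fin d)} (hv : ∀ t ∈ s, Measurable (v t))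
    (hw : ∀ t ∈ s, Measurable (w t)) :
    Measurable fun ω => M ω + ∑ t ∈ s, Matrix.vecMulVec (v t ω).ofLp (w t ω).ofLp := by
  rw [measurable_matrix_iff]
  intro i j
  simp only [Matrix.add_apply, Matrix.sum_apply, Matrix.vecMulVec_apply]
  refine (measurable_matrix_iff.1 hM i j).add (Finset.measurable_fun_sum _ fun t ht => ?_)
  have := hv t ht
  have := hw t ht
  fun_prop

variable {S₀ : Ω → Matrix (Fin d) (Fin d) ℝ} {x : ℕ → Ω → EuclideanSpace ℝ (Fin d)}

lemma measurable_zVec (hS : Measurable S₀) (hpos : ∀ ω, (S₀ ω).PosDef) {t : ℕ} (ht : 1 ≤ t)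
    (hx : ∀ i ∈ Finset.Icc 1 t, Measurable (x i)) :
    Measurable fun ω => zVec (S₀ ω) (fun i => x i ω) t := by
  have hsub : ∀ i ∈ Finset.Icc 1 (t - 1), Measurable (x i) := fun i hi =>
    hx i (Finset.Icc_subset_Icc le_rfl (Nat.sub_le _ _) hi)
  exact measurable_toEuclideanCLM_apply (measurable_matrix_inv (measurable_matrix_sqrt
    (measurable_add_sum_vecMulVec hS hsub hsub)
    fun ω => (posDef_sigmaMat _ (hpos ω) _).posSemidef.nonneg))
    (hx t (Finset.mem_Icc.2 ⟨ht, le_rfl⟩))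

lemma measurable_variabilityMat (hS : Measurable S₀) (hpos : ∀ ω, (S₀ ω).PosDef) {t : ℕ}
    (hx : ∀ i ∈ Finset.Icc 1 t, Measurable (x i)) :
    Measurable fun ω => variabilityMat (S₀ ω) (fun i => x i ω) t := by
  have hz : ∀ s ∈ Finset.Icc 1 t, Measurable fun ω => zVec (S₀ ω) (fun i => x i ω) s :=
    fun s hs => measurable_zVec hS hpos (Finset.mem_Icc.1 hs).1 fun i hi =>
      hx i (Finset.Icc_subset_Icc le_rfl (Finset.mem_Icc.1 hs).2 hi)
  exact measurable_matrix_inv (measurable_add_sum_vecMulVec measurable_const hz hz)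

lemma measurable_weight (hS : Measurable S₀) (hpos : ∀ ω, (S₀ ω).PosDef) {t : ℕ} (ht : 1 ≤ t)
    (hx : ∀ i ∈ Finset.Icc 1 t, Measurable (x i)) :
    Measurable fun ω => weight (S₀ ω) (fun i => x i ω) t := by
  have hz := measurable_zVec hS hpos ht hx
  have h1 := measurable_toEuclideanCLM_apply (measurable_variabilityMat hS hpos
    fun i hi => hx i (Finset.Icc_subset_Icc le_rfl (Nat.sub_le t 1) hi)) hz
  have h2 := measurable_toEuclideanCLM_apply (measurable_variabilityMat hS hpos hx) hz
  exact (measurable_const.add (hz.inner h1)).sqrt.smul h2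

lemma measurable_weightedDesign (hS : Measurable S₀) (hpos : ∀ ω, (S₀ ω).PosDef) {n : ℕ}
    (hx : ∀ i ∈ Finset.Icc 1 n, Measurable (x i)) :
    Measurable fun ω => weightedDesign (S₀ ω) (fun i => x i ω) n := by
  have := measurable_add_sum_vecMulVec (M := fun _ : Ω => (0 : Matrix (Fin d) (Fin d) ℝ))
    measurable_const (s := Finset.Icc 1 n)
    (v := fun t ω => weight (S₀ ω) (fun i => x i ω) t) (w := x)
    (fun t ht => measurable_weight hS hpos (Finset.mem_Icc.1 ht).1 fun i hi =>
      hx i (Finset.Icc_subset_Icc le_rfl (Finset.mem_Icc.1 ht).2 hi)) hx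
  simpa [weightedDesign] using this

end Measurability

/-- A nonintegrable function has conditional expectation `0` by convention, so a nonzero conditional
variance already forces square integrability. -/
lemma memLp_two_of_condExp_sq {Ω : Type*} {m m0 : MeasurableSpace Ω} {μ : Measure Ω}
    [IsProbabilityMeasure μ] {ε : Ω → ℝ} (hε : Measurable ε) {v : ℝ}
    (hv : v ≠ 0) (h : μ[fun ω => ε ω ^ 2 | m] =ᵐ[μ] fun _ => v) : MemLp ε 2 μ := by
  rw [memLp_two_iff_integrable_sq hε.aestronglyMeasurable]
  by_contra hn
  rw [condExp_of_not_integrable hn] at h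
  obtain ⟨ω, hω⟩ := h.exists
  exact hv hω.symm

/-! ### The bound at a fixed horizon -/

section SingleHorizon

variable {Ω : Type*} {m0 : MeasurableSpace Ω} {μ : Measure Ω} [IsProbabilityMeasure μ]

/-- Comparison of the characteristic function of `T` with the Gaussian one, when `T` agrees with a
martingale transform of conditional variance close to `c` outside a small event. -/
lemma norm_integral_exp_sub_exp_le {T S Q : Ω → ℝ} {c κ r : ℝ} {E : Set Ω}
    (hT : AEMeasurable T μ) (hS : Measurable S) (hQ : Measurable Q) (hQc : ∀ ω, Q ω ≤ c)
    (hκ : 0 ≤ κ) (hTS : ∀ ω ∉ E, T ω = S ω) (hQE : ∀ ω ∉ E, c - 2 * κ ≤ Q ω)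
    (hr : ‖∫ ω, Complex.exp (S ω * Complex.I) * Real.exp (Q ω / 2) ∂μ - 1‖
      ≤ Real.exp (c / 2) * r) :
    ‖∫ ω, Complex.exp (T ω * Complex.I) ∂μ - Real.exp (-(c / 2))‖ ≤ r + κ + 2 * μ.real E := by
  set Y : Ω → ℂ := fun ω => Complex.exp (S ω * Complex.I) * Real.exp (Q ω / 2) with hY
  have hYn : ∀ ω, ‖Y ω‖ = Real.exp (Q ω / 2) := fun ω => by
    simp only [hY]
    rw [norm_mul, Complex.norm_exp_ofReal_mul_I, one_mul, Complex.norm_real,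
      Real.norm_of_nonneg (Real.exp_pos _).le]
  have iY : Integrable Y μ := .of_bound (by fun_prop) (Real.exp (c / 2)) (ae_of_all _ fun ω => by
    rw [hYn]
    have := hQc ω
    gcongr)
  have iT : Integrable (fun ω => Complex.exp (T ω * Complex.I)) μ :=
    .of_bound (by fun_prop) 1 (ae_of_all _ fun ω => by rw [Complex.norm_exp_ofReal_mul_I])
  -- Off `E` the difference has norm `1 - exp((Q - c)/2) ≤ (c - Q)/2 ≤ κ`; on `E` it is at most `2`.
  -- As `E` need not be measurable, its measurable hull, of equal measure, is used.
  have hbound : ∀ ω, ‖Complex.exp (T ω * Complex.I) - Real.exp (-(c / 2)) * Y ω‖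
      ≤ κ + (toMeasurable μ E).indicator (fun _ => 2) ω := fun ω => by
    have h1 : Real.exp (-(c / 2)) * Real.exp (Q ω / 2) ≤ 1 := by
      rw [← Real.exp_add]
      exact Real.exp_le_one_iff.2 (by linarith [hQc ω])
    by_cases hω : ω ∈ E
    · rw [Set.indicator_of_mem (subset_toMeasurable μ E hω)]
      refine (norm_sub_le _ _).trans ?_
      rw [Complex.norm_exp_ofReal_mul_I, norm_mul, hYn, Complex.norm_real,
        Real.norm_of_nonneg (Real.exp_pos _).le]
      linarith
    · have h0 : 0 ≤ (toMeasurable μ E).indicator (fun _ => (2 : ℝ)) ω :=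
        Set.indicator_nonneg (fun _ _ => by norm_num) _
      have e : Complex.exp (T ω * Complex.I) - Real.exp (-(c / 2)) * Y ω
          = Complex.exp (S ω * Complex.I)
            * ((1 - Real.exp (-(c / 2)) * Real.exp (Q ω / 2) : ℝ) : ℂ) := by
        rw [hTS ω hω]
        simp only [hY]
        push_cast
        ring
      rw [e, norm_mul, Complex.norm_exp_ofReal_mul_I, one_mul, Complex.norm_real,
        Real.norm_of_nonneg (by linarith), ← Real.exp_add]
      have := Real.add_one_le_exp (-(c / 2) + Q ω / 2)
      linarith [hQE ω hω]
  have hm : MeasurableSet (toMeasurable μ E) := measurableSet_toMeasurable μ E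
  have e : ∫ ω, Complex.exp (T ω * Complex.I) ∂μ - Real.exp (-(c / 2))
      = ∫ ω, (Complex.exp (T ω * Complex.I) - Real.exp (-(c / 2)) * Y ω) ∂μ
        + Real.exp (-(c / 2)) * (∫ ω, Y ω ∂μ - 1) := by
    rw [integral_sub iT (iY.const_mul _), integral_const_mul]
    ring
  rw [e]
  refine (norm_add_le _ _).trans ?_
  have b1 : ‖∫ ω, (Complex.exp (T ω * Complex.I) - Real.exp (-(c / 2)) * Y ω) ∂μ‖
      ≤ κ + 2 * μ.real E := by
    have i2 : Integrable ((toMeasurable μ E).indicator fun _ => (2 : ℝ)) μ :=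
      (integrable_const _).indicator hm
    have i3 : Integrable (fun ω => κ + (toMeasurable μ E).indicator (fun _ => (2 : ℝ)) ω) μ :=
      (integrable_const κ).add i2
    refine (norm_integral_le_of_norm_le i3 (ae_of_all _ hbound)).trans ?_
    rw [integral_add (integrable_const _) i2,
      integral_indicator_const _ hm]
    simp [measureReal_def, measure_toMeasurable, mul_comm]
  have b2 : ‖(Real.exp (-(c / 2)) : ℂ) * (∫ ω, Y ω ∂μ - 1)‖ ≤ r := by
    rw [norm_mul, Complex.norm_real, Real.norm_of_nonneg (Real.exp_pos _).le]
    refine (mul_le_mul_of_nonneg_left hr (Real.exp_pos _).le).trans_eq ?_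
    rw [← mul_assoc, ← Real.exp_add]
    simp
  linarith

variable {d : ℕ}

/-- The estimation error in terms of the noise. -/
lemma toEuclideanCLM_weightedDesign_sub {S₀ : Matrix (Fin d) (Fin d) ℝ}
    {x : ℕ → EuclideanSpace ℝ (Fin d)} {y ε : ℕ → ℝ} {n : ℕ} {θ θstar : EuclideanSpace ℝ (Fin d)}
    (hmodel : ∀ t ∈ Finset.Icc 1 n, y t = inner ℝ (x t) θstar + ε t)
    (h : IsALEE S₀ x y n θ) :
    Matrix.toEuclideanCLM (𝕜 := ℝ) (weightedDesign S₀ x n) (θ - θstar)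
      = ∑ t ∈ Finset.Icc 1 n, ε t • weight S₀ x t := by
  have h1 : Matrix.toEuclideanCLM (𝕜 := ℝ) (weightedDesign S₀ x n) (θ - θstar)
      = ∑ t ∈ Finset.Icc 1 n, (inner ℝ (x t) (θ - θstar)) • weight S₀ x t := by
    rw [weightedDesign, map_sum, sum_apply]
    refine Finset.sum_congr rfl fun t _ => ?_
    ext i
    simp [Matrix.vecMulVec_mulVec, inner_eq_dotProduct_ofLp, mul_comm, sub_mul]
  rw [h1, ← sub_eq_zero, ← neg_eq_zero, ← h, ← Finset.sum_sub_distrib, ← Finset.sum_neg_distrib]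
  refine Finset.sum_congr rfl fun t ht => ?_
  rw [hmodel t ht, ← sub_smul, ← neg_smul, inner_sub_right]
  congr 1
  ring

lemma sum_Icc_one_eq_sum_range {M : Type*} [AddCommMonoid M] (f : ℕ → M) (n : ℕ) :
    ∑ t ∈ Finset.Icc 1 n, f t = ∑ s ∈ Finset.range n, f (s + 1) := by
  rw [Finset.range_eq_Ico, Finset.sum_Ico_add' f 0 n 1]
  rfl

/-- Non-asymptotic bound for the characteristic function of the normalised ALEE error. -/
lemma norm_charFun_alee_sub_le (ℱ : Filtration ℕ m0) {n : ℕ}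
    {x : ℕ → Ω → EuclideanSpace ℝ (Fin d)} {ε y : ℕ → Ω → ℝ}
    {θstar : EuclideanSpace ℝ (Fin d)} {σ δ γ L : ℝ} {K : NNReal} (hσ : 0 < σ)
    (hγ₀ : 0 < γ) (hγ₁ : γ ≤ 1) (hγδ : γ ≤ δ) (hL : 0 < L)
    (hmodel : ∀ t ∈ Finset.Icc 1 n, ∀ ω, y t ω = inner ℝ (x t ω) θstar + ε t ω)
    (hx_meas : ∀ t ∈ Finset.Icc 1 n, Measurable[ℱ (t - 1)] (x t))
    (hy_adapted : ∀ t ∈ Finset.Icc 1 n, t < n → Measurable[ℱ t] (y t))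
    (hy_meas : ∀ t ∈ Finset.Icc 1 n, Measurable (y t))
    (hx_norm : ∀ t ∈ Finset.Icc 1 n, ∀ᵐ ω ∂μ, ‖x t ω‖ ≤ 1)
    (hε_mean : ∀ t ∈ Finset.Icc 1 n, μ[ε t | ℱ (t - 1)] =ᵐ[μ] 0)
    (hε_var : ∀ t ∈ Finset.Icc 1 n,
      μ[fun ω => ε t ω ^ 2 | ℱ (t - 1)] =ᵐ[μ] fun _ => σ ^ 2)
    {S₀ : Ω → Matrix (Fin d) (Fin d) ℝ}
    (hS₀_meas : ∀ i j, Measurable[ℱ 0] (fun ω => S₀ ω i j))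
    (hS₀_pos : ∀ ω, (S₀ ω).PosDef)
    {θhat : Ω → EuclideanSpace ℝ (Fin d)} (hθhat_meas : AEMeasurable θhat μ)
    (u : EuclideanSpace ℝ (Fin d)) :
    ‖∫ ω, Complex.exp ((inner ℝ u ((1 / σ) • Matrix.toEuclideanCLM (𝕜 := ℝ)
          (weightedDesign (S₀ ω) (fun t => x t ω) n) (θhat ω - θstar)) : ℝ) * Complex.I) ∂μ
        - Real.exp (-(‖u‖ ^ 2 / 2))‖
      ≤ (4 * ((‖u‖ / √L) ^ γ * (1 + K)) + (‖u‖ / √L) ^ 2) * ‖u‖ ^ 2 + ‖u‖ ^ 2 / L / 2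
        + 2 * (μ.real {ω | IsALEE (S₀ ω) (fun t => x t ω) (fun t => y t ω) n (θhat ω)}ᶜ
          + μ.real {ω | (K : ℝ≥0∞) < ⨆ t ∈ Finset.Icc 1 n, condLExp (ℱ (t - 1)) μ
              (fun ω' => ENNReal.ofReal (|ε t ω' / σ| ^ (2 + δ))) ω}
          + μ.real {ω | lambdaMin (S₀ ω) ≤ L}
          + μ.real {ω | lambdaMin (variabilityMat (S₀ ω) (fun t => x t ω) n)⁻¹ ≤ L}) := by
  have hmem : ∀ {s}, s < n → s + 1 ∈ Finset.Icc 1 n := fun hs => Finset.mem_Icc.2 (by omega)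
  set ρ := ‖u‖ / √L
  have hρ : 0 ≤ ρ := by positivity
  have hS₀m : ∀ s, Measurable[ℱ s] S₀ := fun s => by
    rw [@measurable_matrix_iff _ _ (ℱ s)]
    exact fun i j => (hS₀_meas i j).mono (ℱ.mono (Nat.zero_le s)) le_rfl
  have hε_eq : ∀ t ∈ Finset.Icc 1 n, ε t = fun ω => y t ω - inner ℝ (x t ω) θstar :=
    fun t ht => by ext ω; rw [hmodel t ht ω]; ring
  have hxm : ∀ t ∈ Finset.Icc 1 n, Measurable (x t) := fun t ht =>
    (hx_meas t ht).mono (ℱ.le _) le_rfl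
  have hεm : ∀ t ∈ Finset.Icc 1 n, Measurable (ε t) := fun t ht => by
    rw [hε_eq t ht]
    exact (hy_meas t ht).sub ((hxm t ht).inner measurable_const)
  have hεa : ∀ t ∈ Finset.Icc 1 n, t < n → Measurable[ℱ t] (ε t) := fun t ht htn => by
    rw [hε_eq t ht]
    exact (hy_adapted t ht htn).sub
      (((hx_meas t ht).mono (ℱ.mono (Nat.sub_le t 1)) le_rfl).inner measurable_const)
  set ξ : ℕ → Ω → ℝ := fun s ω => ε (s + 1) ω / σ with hξ
  set q : ℕ → Ω → ℝ≥0∞ := fun s =>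
    condLExp (ℱ s) μ (fun ω' => ENNReal.ofReal (|ξ s ω'| ^ (2 + δ))) with hq
  set b : ℕ → Ω → ℝ := fun s ω =>
    inner ℝ u (weight (S₀ ω) (fun t => x t ω) (s + 1)) with hb
  -- Coefficients are switched off where the conditional moment exceeds `K` or their size exceeds
  -- `ρ`. As `G s` lies in `ℱ s`, predictability survives and the bounds hold at every `ω`; outside
  -- the exceptional events nothing is switched off.
  set G : ℕ → Set Ω := fun s => {ω | q s ω ≤ K ∧ |b s ω| ≤ ρ} with hG
  set a : ℕ → Ω → ℝ := fun s => (G s).indicator (b s) with ha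
  have hbm : ∀ s < n, Measurable[ℱ s] (b s) := fun s hs =>
    (measurable_const (a := u)).inner (@measurable_weight _ _ (ℱ s) _ _ (hS₀m s) hS₀_pos _
      (Nat.le_add_left 1 s) fun i hi => (hx_meas i (Finset.mem_Icc.2
        ⟨(Finset.mem_Icc.1 hi).1, (Finset.mem_Icc.1 hi).2.trans hs⟩)).mono
          (ℱ.mono (Nat.sub_le_iff_le_add.2 (Finset.mem_Icc.1 hi).2)) le_rfl)
  have hGm : ∀ s < n, MeasurableSet[ℱ s] (G s) := fun s hs =>
    (measurable_condLExp _ _ _ measurableSet_Iic).inter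
      ((show Measurable[ℱ s] fun ω => |b s ω| from
        continuous_abs.measurable.comp (hbm s hs)) measurableSet_Iic)
  have ham : ∀ s < n, Measurable[ℱ s] (a s) := fun s hs => (hbm s hs).indicator (hGm s hs)
  have ha0 : ∀ s < n, Measurable (a s) := fun s hs => (ham s hs).mono (ℱ.le s) le_rfl
  have hε2 : ∀ t ∈ Finset.Icc 1 n, MemLp (ε t) 2 μ := fun t ht =>
    memLp_two_of_condExp_sq (hεm t ht) (by positivity) (hε_var t ht)
  have hξ_eq : ∀ s, ξ s = σ⁻¹ • ε (s + 1) := fun s => by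
    ext ω
    simp [hξ, div_eq_inv_mul]
  have hξm : ∀ s < n, Measurable (ξ s) := fun s hs => (hεm _ (hmem hs)).div_const σ
  have ha_sq : ∀ s ω, a s ω ^ 2 ≤ b s ω ^ 2 := fun s ω => by
    simp only [ha, Set.indicator_apply]
    split_ifs
    · exact le_rfl
    · simpa using sq_nonneg (b s ω)
  have hsum : ∀ ω, ∑ s ∈ Finset.range n, a s ω ^ 2 ≤ ‖u‖ ^ 2 := fun ω =>
    (Finset.sum_le_sum fun s _ => ha_sq s ω).trans (sum_inner_weight_sq_le _ u n)
  have main := norm_integral_exp_sum_sub_one_le (μ := μ) ℱ n (a := a) (ξ := ξ) (c := ‖u‖ ^ 2)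
    (ρ := ρ) (δ := δ) (γ := γ) (K := K) hγ₀ hγ₁ hγδ ham hξm
    (fun s hs => (hεa _ (hmem (by omega)) hs).div_const σ)
    (fun s hs => by rw [hξ_eq]; exact (hε2 _ (hmem hs)).const_smul _)
    (fun s hs => by
      rw [hξ_eq]
      filter_upwards [condExp_smul σ⁻¹ (ε (s + 1)) (ℱ s), hε_mean _ (hmem hs)] with ω h1 h2
      rw [Nat.add_sub_cancel] at h2
      rw [h1, Pi.smul_apply, h2]
      simp)
    (fun s hs => by
      have e : (fun ω => ξ s ω ^ 2) = (σ ^ 2)⁻¹ • fun ω => ε (s + 1) ω ^ 2 := by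
        ext ω
        simp [hξ, div_eq_inv_mul, mul_pow]
      rw [e]
      filter_upwards [condExp_smul (σ ^ 2)⁻¹ (fun ω => ε (s + 1) ω ^ 2) (ℱ s),
        hε_var _ (hmem hs)] with ω h1 h2
      rw [Nat.add_sub_cancel] at h2
      rw [h1, Pi.smul_apply, h2, smul_eq_mul, inv_mul_cancel₀ (by positivity)])
    (fun s _ ω => by
      simp only [ha, Set.indicator_apply]
      split_ifs with h
      · exact h.2
      · simpa using hρ)
    (fun s _ ω h => by
      have : ω ∈ G s := by
        by_contra hn
        exact h (Set.indicator_of_notMem hn _)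
      exact this.1)
    hsum hρ
  set E₁ := {ω | IsALEE (S₀ ω) (fun t => x t ω) (fun t => y t ω) n (θhat ω)}ᶜ
  set E₂ := {ω | (K : ℝ≥0∞) < ⨆ t ∈ Finset.Icc 1 n, condLExp (ℱ (t - 1)) μ
              (fun ω' => ENNReal.ofReal (|ε t ω' / σ| ^ (2 + δ))) ω} with hE₂
  set E₃ := {ω | lambdaMin (S₀ ω) ≤ L}
  set E₄ := {ω | lambdaMin (variabilityMat (S₀ ω) (fun t => x t ω) n)⁻¹ ≤ L}
  set E₅ := {ω | ∀ t ∈ Finset.Icc 1 n, ‖x t ω‖ ≤ 1}ᶜ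
  have hE₅ : μ.real E₅ = 0 := by
    rw [measureReal_def, mem_ae_iff.1 ((Finset.eventually_all _).2 hx_norm)]
    rfl
  have hab : ∀ ω ∉ E₁ ∪ E₂ ∪ E₃ ∪ E₄ ∪ E₅, ∀ s < n, a s ω = b s ω := by
    intro ω hω s hs
    simp only [Set.mem_union, not_or] at hω
    obtain ⟨⟨⟨⟨-, h2⟩, h3⟩, -⟩, h5⟩ := hω
    have hωG : ω ∈ G s := by
      refine ⟨?_, ?_⟩
      · exact (le_iSup₂ (f := fun t (_ : t ∈ Finset.Icc 1 n) => condLExp (ℱ (t - 1)) μ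
          (fun ω' => ENNReal.ofReal (|ε t ω' / σ| ^ (2 + δ))) ω) (s + 1) (hmem hs)).trans
          (not_lt.1 h2)
      · exact abs_inner_weight_le _ (hS₀_pos ω) hL (not_le.1 h3).le u s
          ((Set.notMem_compl_iff.1 h5) _ (hmem hs))
    exact Set.indicator_of_mem hωG _
  have fin := norm_integral_exp_sub_exp_le (μ := μ) (E := E₁ ∪ E₂ ∪ E₃ ∪ E₄ ∪ E₅)
    (T := fun ω => inner ℝ u ((1 / σ) • Matrix.toEuclideanCLM (𝕜 := ℝ)
          (weightedDesign (S₀ ω) (fun t => x t ω) n) (θhat ω - θstar)))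
    (S := fun ω => ∑ s ∈ Finset.range n, a s ω * ξ s ω)
    (Q := fun ω => ∑ s ∈ Finset.range n, a s ω ^ 2) (c := ‖u‖ ^ 2) (κ := ‖u‖ ^ 2 / L / 2)
    (r := (4 * (ρ ^ γ * (1 + K)) + ρ ^ 2) * ‖u‖ ^ 2)
    (by
      have hD : Measurable fun ω => weightedDesign (S₀ ω) (fun t => x t ω) n :=
        measurable_weightedDesign ((hS₀m 0).mono (ℱ.le 0) le_rfl) hS₀_pos hxm
      have hmk : Measurable fun ω => Matrix.toEuclideanCLM (𝕜 := ℝ)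
          (weightedDesign (S₀ ω) (fun t => x t ω) n) (hθhat_meas.mk θhat ω - θstar) :=
        measurable_toEuclideanCLM_apply hD (hθhat_meas.measurable_mk.sub_const _)
      refine ⟨fun ω => inner ℝ u ((1 / σ) • Matrix.toEuclideanCLM (𝕜 := ℝ)
          (weightedDesign (S₀ ω) (fun t => x t ω) n) (hθhat_meas.mk θhat ω - θstar)),
        (measurable_const (a := u)).inner (hmk.const_smul (1 / σ)), ?_⟩
      filter_upwards [hθhat_meas.ae_eq_mk] with ω hω
      rw [hω])
    (Finset.measurable_fun_sum _ fun s hs =>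
      (ha0 s (Finset.mem_range.1 hs)).mul (hξm s (Finset.mem_range.1 hs)))
    (Finset.measurable_fun_sum _ fun s hs => (ha0 s (Finset.mem_range.1 hs)).pow_const 2)
    hsum (by positivity)
    (fun ω hω => by
      have hab' := hab ω hω
      simp only [Set.mem_union, not_or] at hω
      rw [toEuclideanCLM_weightedDesign_sub (fun t ht => hmodel t ht ω)
        (Set.notMem_compl_iff.1 hω.1.1.1.1), sum_Icc_one_eq_sum_range, inner_smul_right, inner_sum,
        Finset.mul_sum]
      refine Finset.sum_congr rfl fun s hs => ?_
      rw [hab' s (Finset.mem_range.1 hs), inner_smul_right]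
      simp only [hb, hξ]
      ring)
    (fun ω hω => by
      have hab' := hab ω hω
      simp only [Set.mem_union, not_or] at hω
      rw [Finset.sum_congr rfl fun s hs => by rw [hab' s (Finset.mem_range.1 hs)]]
      have := le_sum_inner_weight_sq (S₀ := S₀ ω) (fun t => x t ω) u n hL (not_le.1 hω.1.2).le
      simp only [hb]
      linarith)
    (by rw [← mul_assoc]; exact main)
  refine fin.trans ?_
  have hU : μ.real (E₁ ∪ E₂ ∪ E₃ ∪ E₄ ∪ E₅)
      ≤ μ.real E₁ + μ.real E₂ + μ.real E₃ + μ.real E₄ := by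
    have h1 := measureReal_union_le (μ := μ) (E₁ ∪ E₂ ∪ E₃ ∪ E₄) E₅
    have h2 := measureReal_union_le (μ := μ) (E₁ ∪ E₂ ∪ E₃) E₄
    have h3 := measureReal_union_le (μ := μ) (E₁ ∪ E₂) E₃
    have h4 := measureReal_union_le (μ := μ) E₁ E₂
    linarith
  linarith

end SingleHorizon

/-! ### Passage to the limit -/

lemma tendsto_charFun_error_atTop {γ : ℝ} (hγ : 0 < γ) (K v : ℝ) :
    Tendsto (fun L : ℝ => (4 * ((v / √L) ^ γ * (1 + K)) + (v / √L) ^ 2) * v ^ 2 + v ^ 2 / L / 2)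
      atTop (𝓝 0) := by
  have h1 : Tendsto (fun L : ℝ => v / √L) atTop (𝓝 0) :=
    tendsto_const_nhds.div_atTop Real.tendsto_sqrt_atTop
  have h2 : Tendsto (fun L : ℝ => (v / √L) ^ γ) atTop (𝓝 0) := by
    simpa [Real.zero_rpow hγ.ne'] using h1.rpow_const (Or.inr hγ.le)
  have h3 : Tendsto (fun L : ℝ => v ^ 2 / L) atTop (𝓝 0) :=
    tendsto_const_nhds.div_atTop tendsto_id
  simpa using ((((h2.mul_const (1 + K)).const_mul 4).add (h1.pow 2)).mul_const (v ^ 2)).add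
    (h3.div_const 2)

lemma eventually_measureReal_le {Ω : ℕ → Type*} [∀ n, MeasurableSpace (Ω n)]
    {μ : ∀ n, Measure (Ω n)} {E : ∀ n, Set (Ω n)}
    (h : Tendsto (fun n => μ n (E n)) atTop (𝓝 0)) {e : ℝ} (he : 0 < e) :
    ∀ᶠ n in atTop, (μ n).real (E n) ≤ e := by
  filter_upwards [h.eventually_le_const (ENNReal.ofReal_pos.2 he)] with n hn
  exact ENNReal.toReal_le_of_le_ofReal he.le hn

end ContextualALEE

theorem theorem2 {d : ℕ}
    -- for every horizon `n`, a probability space with a filtration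
    {Ω : ℕ → Type*} [mΩ : ∀ n, MeasurableSpace (Ω n)]
    (μ : ∀ n, Measure (Ω n)) [∀ n, IsProbabilityMeasure (μ n)]
    (ℱ : ∀ n, Filtration ℕ (mΩ n))
    -- covariates, noise, responses at times `1, …, n`
    (x : ∀ n, ℕ → Ω n → EuclideanSpace ℝ (Fin d))
    (ε y : ∀ n, ℕ → Ω n → ℝ)
    (θstar : EuclideanSpace ℝ (Fin d)) (σ δ : ℝ) (hσ : 0 < σ) (hδ : 0 < δ)
    -- adaptive linear model
    (hmodel : ∀ n, ∀ t ∈ Finset.Icc 1 n, ∀ ω,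
      y n t ω = inner ℝ (x n t ω) θstar + ε n t ω)
    (hx_meas : ∀ n, ∀ t ∈ Finset.Icc 1 n, Measurable[ℱ n (t - 1)] (x n t))
    (hy_adapted : ∀ n, ∀ t ∈ Finset.Icc 1 n, t < n → Measurable[ℱ n t] (y n t))
    (hy_meas : ∀ n, ∀ t ∈ Finset.Icc 1 n, Measurable (y n t))
    (hx_norm : ∀ n, ∀ t ∈ Finset.Icc 1 n, ∀ᵐ ω ∂(μ n), ‖x n t ω‖ ≤ 1)
    -- conditional mean zero, conditional variance `σ²`
    (hε_mean : ∀ n, ∀ t ∈ Finset.Icc 1 n, (μ n)[ε n t | ℱ n (t - 1)] =ᵐ[μ n] 0)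
    (hε_var : ∀ n, ∀ t ∈ Finset.Icc 1 n,
      (μ n)[fun ω => ε n t ω ^ 2 | ℱ n (t - 1)] =ᵐ[μ n] fun _ => σ ^ 2)
    -- the maximal conditional `(2+δ)`-moment is bounded in probability
    (hε_moment : ∀ η : ℝ≥0∞, 0 < η → ∃ K : NNReal, ∀ᶠ n in atTop,
      μ n {ω | (K : ℝ≥0∞) < ⨆ t ∈ Finset.Icc 1 n,
        condLExp (ℱ n (t - 1)) (μ n)
          (fun ω' => ENNReal.ofReal (|ε n t ω' / σ| ^ (2 + δ))) ω} ≤ η)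
    -- the initial matrix
    (S₀ : ∀ n, Ω n → Matrix (Fin d) (Fin d) ℝ)
    (hS₀_meas : ∀ n i j, Measurable[ℱ n 0] (fun ω => S₀ n ω i j))
    (hS₀_pos : ∀ n ω, (S₀ n ω).PosDef)
    -- the ALEE estimate
    (θhat : ∀ n, Ω n → EuclideanSpace ℝ (Fin d))
    (hθhat_meas : ∀ n, AEMeasurable (θhat n) (μ n))
    (hθhat : ContextualALEE.WithHighProbability μ (fun n =>
      {ω | ContextualALEE.IsALEE (S₀ n ω) (fun t => x n t ω) (fun t => y n t ω) n (θhat n ω)}))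
    -- `λ_min(Σ_0) → ∞` and `λ_min(V_n⁻¹) → ∞` in probability
    (hS₀_lim : ContextualALEE.TendstoInProbabilityAtTop μ
      (fun n ω => ContextualALEE.lambdaMin (S₀ n ω)))
    (hV_lim : ContextualALEE.TendstoInProbabilityAtTop μ
      (fun n ω => ContextualALEE.lambdaMin
        (ContextualALEE.variabilityMat (S₀ n ω) (fun t => x n t ω) n)⁻¹)) :
    TendstoInDistribution
      (fun n ω => (1 / σ) •
        Matrix.toEuclideanCLM (𝕜 := ℝ)
          (ContextualALEE.weightedDesign (S₀ n ω) (fun t => x n t ω) n)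
          (θhat n ω - θstar))
      atTop (id : EuclideanSpace ℝ (Fin d) → EuclideanSpace ℝ (Fin d)) μ
      (multivariateGaussian 0 (1 : Matrix (Fin d) (Fin d) ℝ)) := by
  have haem : ∀ n, AEMeasurable (fun ω => (1 / σ) • Matrix.toEuclideanCLM (𝕜 := ℝ)
      (ContextualALEE.weightedDesign (S₀ n ω) (fun t => x n t ω) n) (θhat n ω - θstar)) (μ n) := by
    intro n
    have hS : Measurable (S₀ n) := ContextualALEE.measurable_matrix_iff.2 fun i j =>
      (hS₀_meas n i j).mono ((ℱ n).le 0) le_rfl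
    have hD := ContextualALEE.measurable_weightedDesign hS (hS₀_pos n) (n := n)
      fun t ht => (hx_meas n t ht).mono ((ℱ n).le _) le_rfl
    have hmk := (ContextualALEE.measurable_toEuclideanCLM_apply hD
      ((hθhat_meas n).measurable_mk.sub_const θstar)).const_smul (1 / σ)
    refine hmk.aemeasurable.congr ?_
    filter_upwards [(hθhat_meas n).ae_eq_mk] with ω hω
    rw [Pi.smul_apply, hω]
  refine ⟨haem, aemeasurable_id, ProbabilityMeasure.tendsto_of_tendsto_charFun fun u => ?_⟩
  have hlim : charFun ((multivariateGaussian 0 (1 : Matrix (Fin d) (Fin d) ℝ)).map id) u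
      = (Real.exp (-(‖u‖ ^ 2 / 2)) : ℂ) := by
    rw [Measure.map_id, charFun_multivariateGaussian Matrix.PosSemidef.one]
    simp [← ContextualALEE.norm_sq_eq_dotProduct_ofLp]
  simp only [ProbabilityMeasure.coe_mk, hlim]
  -- The exponent is capped at `1` because the Taylor bound gains at most a cubic remainder.
  have hγ₀ : 0 < min δ 1 := lt_min hδ one_pos
  rw [Metric.tendsto_nhds]
  intro e he
  -- `K` comes before `L`, since the deterministic error depends on `K` and is made small by
  -- enlarging `L`. The four exceptional events enter with factor `2`, so the total is below `e/2 +
  -- 2 · 4 · e/16 = e`.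
  obtain ⟨K, hK⟩ := hε_moment (ENNReal.ofReal (e / 16)) (ENNReal.ofReal_pos.2 (by positivity))
  obtain ⟨L, hLe, hL⟩ := (((ContextualALEE.tendsto_charFun_error_atTop hγ₀ K ‖u‖).eventually_lt_const
    (by positivity : (0 : ℝ) < e / 2)).and (eventually_gt_atTop 0)).exists
  filter_upwards [hK, ContextualALEE.eventually_measureReal_le hθhat (by positivity : 0 < e / 16),
    ContextualALEE.eventually_measureReal_le (hS₀_lim L) (by positivity : 0 < e / 16),
    ContextualALEE.eventually_measureReal_le (hV_lim L) (by positivity : 0 < e / 16)]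
    with n h2 h1 h3 h4
  have h2' := ENNReal.toReal_le_of_le_ofReal (by positivity) h2
  rw [← measureReal_def] at h2'
  have key := ContextualALEE.norm_charFun_alee_sub_le (ℱ n) (K := K) (δ := δ) hσ hγ₀
    (min_le_right δ 1) (min_le_left δ 1) hL (hmodel n) (hx_meas n) (hy_adapted n) (hy_meas n)
    (hx_norm n) (hε_mean n) (hε_var n) (hS₀_meas n) (hS₀_pos n) (hθhat_meas n) u
  rw [dist_eq_norm, charFun_apply, integral_map (haem n) (by fun_prop)]
  simp_rw [real_inner_comm u]
  linarith
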